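/- All simplicial complexes are finite abstract simplicial complexes. A \emph{saw blade complex} is a $2$-dimensional simplicial complex $K$ obtained from a triangulated disk $D$ (a simplicial complex whose geometric realization is homeomorphic to the closed disk) by identifying vertices on the boundary of $D$, in such a way that no simplex of $D$ degenerates (the vertices of each simplex keep distinct images) and - no interior edge of $D$ is identified with any other edge of $D$; - the identification of the boundary vertices of $D$ is $3$-to-$1$, and so is the identification of the boundary edges of $D$; - the identified boundary edges form a cycle $C$ in $K$ (a simple cycle of length $n\ge 3$); - along the boundary of $D$, traversed once, each edge of $C$ appears exactly twice with one orientation and exactly once with the opposite orientation. Here a boundary edge of $D$ is an edge contained in exactly one triangle, the boundary edges form a closed cycle whose vertices are the boundary vertices, and all other edges are interior. The faces of $K$ are the images of the faces of $D$. An \emph{elementary collapse} of a simplicial complex deletes a free face $\sigma$, i.e. a nonempty face properly contained in exactly one face $\tau$, where $\dim\tau=\dim\sigma+1$, together with $\tau$. A complex is \emph{collapsible} if some finite sequence of elementary collapses reduces it to a single vertex. \textbf{Theorem.} Let $K$ be a saw blade complex. Then (the geometric realization of) $K$ is contractible, but $K$ is not collapsible. -/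

import Mathlib

namespace SawBlade

/-- The geometric realization of a finite abstract simplicial complex, in barycentric coordinates:
the points of the standard simplex on the vertex set that are supported on a face. It carries the
subspace topology of the finite-dimensional real space of functions on the vertices. -/
def realization {V : Type*} [Fintype V] (K : PreAbstractSimplicialComplex V) : Set (V → ℝ) :=
  {x | x ∈ stdSimplex ℝ V ∧ ∃ s ∈ K.faces, ∀ v, x v ≠ 0 → v ∈ s}

/-- A triangulated disk: a finite simplicial complex of dimension at most two whose realization is
homeomorphic to the closed unit disk in the Euclidean plane. -/
def IsTriangulatedDisk {V : Type*} [Fintype V] (D : PreAbstractSimplicialComplex V) : Prop :=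
  (∀ s ∈ D.faces, s.card ≤ 3) ∧
    Nonempty (realization D ≃ₜ Metric.closedBall (0 : EuclideanSpace ℝ (Fin 2)) 1)

/-- An edge of the complex. -/
def IsEdge {V : Type*} (D : PreAbstractSimplicialComplex V) (e : Finset V) : Prop :=
  e ∈ D.faces ∧ e.card = 2

/-- A boundary edge of a two-dimensional complex: an edge contained in exactly one triangle. The
remaining edges of a triangulated disk are its interior edges. -/
def IsBoundaryEdge {V : Type*} (D : PreAbstractSimplicialComplex V) (e : Finset V) : Prop :=
  IsEdge D e ∧ ∃! t : Finset V, t ∈ D.faces ∧ t.card = 3 ∧ e ⊆ t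

/-- `b` lists the vertices of the boundary of `D` in cyclic order: the `b i` are distinct, and the
boundary edges are exactly the edges from `b i` to `b (i + 1)`. -/
def IsBoundaryCycle {V : Type*} [DecidableEq V] (D : PreAbstractSimplicialComplex V) {m : ℕ}
    (b : ZMod m → V) : Prop :=
  3 ≤ m ∧ Function.Injective b ∧ ∀ e, IsBoundaryEdge D e ↔ ∃ i, e = {b i, b (i + 1)}

/-- `K` is obtained from the triangulated disk `D`, with boundary cycle `b`, through the vertex
identification `q`, and this makes it a saw blade complex, whose identified boundary is the
cycle `c`. -/
structure IsSawBladeIdentification {V W : Type*} [Fintype V] [DecidableEq V] [DecidableEq W]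
    (D : PreAbstractSimplicialComplex V) {m : ℕ} (b : ZMod m → V) (q : V → W)
    (K : PreAbstractSimplicialComplex W) {n : ℕ} (c : ZMod n → W) : Prop where
  disk : IsTriangulatedDisk D
  boundary : IsBoundaryCycle D b
  /-- The faces of `K` are the images of the faces of `D`. -/
  image_eq : K = D.map q
  /-- The result is a simplicial complex: no simplex of the disk degenerates. -/
  nondegenerate : ∀ s ∈ D.faces, Set.InjOn q (s : Set V)
  /-- Only vertices on the boundary are identified. -/
  only_boundary : ∀ u w, {u} ∈ D.faces → {w} ∈ D.faces → q u = q w → u ≠ w →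
    u ∈ Set.range b ∧ w ∈ Set.range b
  /-- No interior edge is identified with another edge. -/
  interior_edges : ∀ e e', IsEdge D e → ¬ IsBoundaryEdge D e → IsEdge D e' →
    e.image q = e'.image q → e = e'
  /-- The identification of the boundary vertices is 3-to-1. -/
  vertices_three : ∀ i, {j | q (b j) = q (b i)}.ncard = 3
  /-- The identification of the boundary edges is 3-to-1. -/
  edges_three : ∀ i,
    {j | ({q (b j), q (b (j + 1))} : Finset W) = {q (b i), q (b (i + 1))}}.ncard = 3
  /-- The identified boundary edges form a cycle of length at least three. -/
  three_le : 3 ≤ n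
  cycle_injective : Function.Injective c
  cycle : ∀ e : Finset W, (∃ i, e = {q (b i), q (b (i + 1))}) ↔ ∃ k, e = {c k, c (k + 1)}
  /-- Along the boundary of the disk, each identified edge appears twice with one orientation and
  once with the opposite one. -/
  orientation : ∀ k,
    ({i | q (b i) = c k ∧ q (b (i + 1)) = c (k + 1)}.ncard = 2 ∧
      {i | q (b i) = c (k + 1) ∧ q (b (i + 1)) = c k}.ncard = 1) ∨
    ({i | q (b i) = c k ∧ q (b (i + 1)) = c (k + 1)}.ncard = 1 ∧
      {i | q (b i) = c (k + 1) ∧ q (b (i + 1)) = c k}.ncard = 2)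

/-- A saw blade complex. -/
def IsSawBladeComplex {W : Type*} [DecidableEq W] (K : PreAbstractSimplicialComplex W) : Prop :=
  ∃ (V : Type) (_ : Fintype V) (_ : DecidableEq V) (D : PreAbstractSimplicialComplex V)
    (m : ℕ) (b : ZMod m → V) (q : V → W) (n : ℕ) (c : ZMod n → W),
    IsSawBladeIdentification D b q K c

/-- `σ` is a free face of `K`, and `τ`, of one dimension more, is the only face of `K` that properly
contains it. -/
def IsFreeFace {W : Type*} (K : PreAbstractSimplicialComplex W) (σ τ : Finset W) : Prop :=
  σ ∈ K.faces ∧ τ ∈ K.faces ∧ τ.card = σ.card + 1 ∧ ∀ ρ, ρ ∈ K.faces ∧ σ ⊂ ρ ↔ ρ = τ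

/-- `L` is obtained from `K` by an elementary collapse: a free face and the face containing it are
deleted. -/
def ElementaryCollapse {W : Type*} (K L : PreAbstractSimplicialComplex W) : Prop :=
  ∃ σ τ, IsFreeFace K σ τ ∧ L.faces = K.faces \ {σ, τ}

/-- `K` is collapsible: a finite sequence of elementary collapses reduces it to a single vertex. -/
def IsCollapsible {W : Type*} (K : PreAbstractSimplicialComplex W) : Prop :=
  ∃ (L : PreAbstractSimplicialComplex W) (v : W),
    L.faces = {{v}} ∧ Relation.ReflTransGen ElementaryCollapse K L

end SawBlade

open Topology Set

namespace SawBlade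

/-! Contractibility. The realization of `K` is a circle (the cycle `c`) with a disk attached along
the image of the boundary walk. The walk visits each vertex of the cycle three times, and each time
it leaves along one of the two adjacent edges. Counting departures forces the majority orientation
to be the same on all edges, so the walk has degree `±1` (`exists_lift_of_walk`) and is homotopic to
a homeomorphism of circles (`exists_homotopy_homeomorph`). Attaching a contractible space along such
a map gives a contractible space: `contractibleSpace_of_attaching` shows that the identity of the
quotient is homotopic to a map factoring through the disk. The collar of the boundary required there
comes from an explicit deformation in barycentric coordinates (`deform`).

Non-collapsibility. No elementary collapse can start, because `K` has no free face
(`not_isFreeFace`). Every edge of the disk lies in a triangle, since an open edge cannot be open in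
a disk (`exists_triangle_of_isEdge`). The boundary has length `3 * n ≥ 9`, so it contains no closed
walk around three or four distinct vertices, and therefore no two triangles are identified
(`triangle_injective`). An interior edge of the disk thus lies in at least two triangles of `K`, and
so does a boundary edge because it is glued to other boundary edges. The same analysis shows that
the projection from the disk identifies points only on the boundary polygon, as the contractibility
argument requires. -/

/-! ### Descent to quotients, and attaching along a map homotopic to a homeomorphism -/

/-- From a compact space to a Hausdorff one, `p × id` is closed and hence a quotient map, so a
homotopy compatible with the fibres of `p` at every time descends. -/
theorem homotopic_of_descends {X Y Z : Type*} [TopologicalSpace X] [TopologicalSpace Y]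
    [TopologicalSpace Z] [CompactSpace X] [T2Space Y] {p : X → Y} (hp : Continuous p)
    (hps : Function.Surjective p) (Ψ : X × unitInterval → Z) (hΨ : Continuous Ψ)
    (hd : ∀ x x' s, p x = p x' → Ψ (x, s) = Ψ (x', s)) (u₀ u₁ : C(Y, Z))
    (h₀ : ∀ x, Ψ (x, 0) = u₀ (p x)) (h₁ : ∀ x, Ψ (x, 1) = u₁ (p x)) :
    u₀.Homotopic u₁ := by
  have hP : Continuous (Prod.map p id : X × unitInterval → Y × unitInterval) := by fun_prop
  have hq : IsQuotientMap (Prod.map p id : X × unitInterval → Y × unitInterval) :=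
    hP.isClosedMap.isQuotientMap hP (hps.prodMap Function.surjective_id)
  let F : unitInterval × Y → Z := fun sy => Ψ ((hps sy.2).choose, sy.1)
  have hF : ∀ x s, F (s, p x) = Ψ (x, s) := fun x s => hd _ _ _ (hps (p x)).choose_spec
  have hFc : Continuous (fun ys : Y × unitInterval => F (ys.2, ys.1)) := by
    rw [hq.continuous_iff]
    convert hΨ using 1
    ext ⟨x, s⟩
    exact hF x s
  refine ⟨⟨⟨F, ?_⟩, ?_, ?_⟩⟩
  · exact hFc.comp continuous_swap
  · intro y
    obtain ⟨x, rfl⟩ := hps y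
    exact (hF x 0).trans (h₀ x)
  · intro y
    obtain ⟨x, rfl⟩ := hps y
    exact (hF x 1).trans (h₁ x)

theorem exists_descent {X Y Z : Type*} [TopologicalSpace X] [TopologicalSpace Y]
    [TopologicalSpace Z] [CompactSpace X] [T2Space Y] {p : X → Y} (hp : Continuous p)
    (hps : Function.Surjective p) (g : X → Z) (hg : Continuous g)
    (hd : ∀ x x', p x = p x' → g x = g x') : ∃ u : C(Y, Z), ∀ x, u (p x) = g x := by
  have hq : IsQuotientMap p := hp.isClosedMap.isQuotientMap hp hps
  have hF : ∀ x, g (hps (p x)).choose = g x := fun x => hd _ _ (hps (p x)).choose_spec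
  refine ⟨⟨fun y => g (hps y).choose, ?_⟩, hF⟩
  rw [hq.continuous_iff]
  convert hg using 1
  ext x
  exact hF x

/-- If `Y` arises from a contractible compact space `X` by identifying points of the image of a
neighbourhood deformation retract `a : T → X` along a map `f : T → T'` that is homotopic to a
homeomorphism, then `Y` is contractible. -/
theorem contractibleSpace_of_attaching {X Y T T' : Type*} [TopologicalSpace X]
    [TopologicalSpace Y] [TopologicalSpace T] [TopologicalSpace T'] [CompactSpace X] [T2Space Y]
    [ContractibleSpace X] {p : X → Y} (hp : Continuous p) (hps : Function.Surjective p)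
    {a : T → X} (ha : Continuous a) (hai : Function.Injective a)
    {j : T' → Y} (hj : Continuous j) (hji : Function.Injective j)
    (hpi : ∀ x x', p x = p x' → x = x' ∨ x ∈ range a ∧ x' ∈ range a)
    {f : T → T'} (hf : ∀ θ, p (a θ) = j (f θ)) (h : T ≃ₜ T')
    {H : T × ℝ → T'} (hH : Continuous H) (H₀ : ∀ θ, H (θ, 0) = f θ) (H₁ : ∀ θ, H (θ, 1) = h θ)
    {α : X → ℝ} (hα : Continuous α) (hαa : ∀ θ, α (a θ) = 1)
    {r : X → T} (hr : ContinuousOn r {x | 1 / 2 ≤ α x})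
    {κ : X × unitInterval → X} (hκ : Continuous κ) (κ₀ : ∀ x, κ (x, 0) = x)
    (κ₁ : ∀ x, 1 / 2 ≤ α x → κ (x, 1) = a (r x)) (κa : ∀ θ s, κ (a θ, s) = a θ) :
    ContractibleSpace Y := by
  classical
  have hra : ∀ θ, r (a θ) = θ := fun θ => hai (by
    rw [← κ₁ _ (by rw [hαa]; norm_num), κa])
  -- maps that restrict to a function of `f` on the image of `a` descend
  have hfib : ∀ x x', p x = p x' → x = x' ∨ ∃ θ θ', f θ = f θ' ∧ x = a θ ∧ x' = a θ' := by
    intro x x' hx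
    rcases hpi x x' hx with rfl | ⟨⟨θ, rfl⟩, ⟨θ', rfl⟩⟩
    · exact Or.inl rfl
    · exact Or.inr ⟨θ, θ', hji (by rw [← hf, ← hf, hx]), rfl, rfl⟩
  have key : ∀ (g : X → Y), (∀ θ θ', f θ = f θ' → g (a θ) = g (a θ')) →
      ∀ x x', p x = p x' → g x = g x' := by
    intro g hg x x' hx
    rcases hfib x x' hx with rfl | ⟨θ, θ', e, rfl, rfl⟩
    · rfl
    · exact hg _ _ e
  -- Collar time: `0` on the image of `a`, and `1` from the level `α = 1 / 2` inwards.
  set τ : X → ℝ := fun x => min 1 (2 * (1 - α x)) with hτ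
  have hτc : Continuous τ := by fun_prop
  have hτa : ∀ θ, τ (a θ) = 0 := by intro θ; simp [hτ, hαa]
  have hτlt : ∀ x, α x ≤ 1 / 2 → τ x = 1 := by
    intro x hx
    simp only [hτ]
    exact min_eq_left (by linarith)
  -- Homotopy extension: `G` extends the homotopy `j ∘ H` from the image of `a` to all of `X`,
  -- starting at `p ∘ κ₁`. The factor `2 * α - 1` freezes it at the inner end of the collar.
  let G : X × ℝ → Y := fun z =>
    if 1 / 2 ≤ α z.1 then j (H (r z.1, z.2 * (2 * α z.1 - 1))) else p (κ (z.1, 1))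
  have hGc : Continuous G := by
    refine continuous_if_le continuous_const (by fun_prop) ?_ (by fun_prop) ?_
    · refine hj.comp_continuousOn (hH.comp_continuousOn (ContinuousOn.prodMk ?_ ?_))
      · exact hr.comp continuousOn_fst (fun z hz => hz)
      · fun_prop
    · rintro ⟨x, t⟩ hx
      have hx' : α x = 1 / 2 := hx.symm
      simp only [hx']
      norm_num
      rw [H₀, ← hf, κ₁ x hx'.ge]
  have hGa : ∀ θ t, G (a θ, t) = j (H (θ, t)) := by
    intro θ t
    simp only [G, hαa, hra]
    norm_num
  have hG0 : ∀ x, G (x, 0) = p (κ (x, 1)) := by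
    intro x
    simp only [G]
    split_ifs with hx
    · rw [zero_mul, H₀, ← hf, κ₁ x hx]
    · rfl
  -- On the image of `a` this is `a ∘ h⁻¹ ∘ f`, so it respects the identifications and descends to a
  -- map from `Y` back to `X`. At `α = 1 / 2` the collar formula becomes `a ∘ r`, which agrees with
  -- `κ₁`.
  let k : X → X := fun x => if 1 / 2 ≤ α x then a (h.symm (H (r x, τ x))) else κ (x, 1)
  have hkc : Continuous k := by
    refine continuous_if_le continuous_const (by fun_prop) ?_ (by fun_prop) ?_
    · exact ha.comp_continuousOn (h.symm.continuous.comp_continuousOn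
        (hH.comp_continuousOn (hr.prodMk hτc.continuousOn)))
    · intro x hx
      rw [hτlt x hx.symm.le, H₁, h.symm_apply_apply, κ₁ x hx.le]
  have hGk : ∀ x, G (κ (x, 1), τ x) = G (k x, 1) := by
    intro x
    simp only [k]
    split_ifs with hx
    · rw [κ₁ x hx, hGa, hGa, H₁, h.apply_symm_apply]
    · rw [hτlt x (not_le.mp hx).le]
  obtain ⟨u, hu⟩ := exists_descent hp hps (fun x => p (κ (x, 1))) (by fun_prop)
    (key _ (fun θ θ' e => by simp only [κa, hf, e]))
  obtain ⟨k', hk'⟩ := exists_descent hp hps k hkc (fun x x' hx => by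
    rcases hfib x x' hx with rfl | ⟨θ, θ', e, rfl, rfl⟩
    · rfl
    · simp only [k, hαa, hra, hτa, H₀, e]
      norm_num)
  let G₁ : C(X, Y) := ⟨fun x => G (x, 1), by fun_prop⟩
  have h1 : (ContinuousMap.id Y).Homotopic u :=
    homotopic_of_descends hp hps (fun z => p (κ z)) (by fun_prop)
      (fun x x' s => key (fun x => p (κ (x, s))) (fun θ θ' e => by simp only [κa, hf, e]) x x')
      _ _ (fun x => by simp [κ₀]) (fun x => by simp [hu])
  -- On the image of `a` the factor `τ` vanishes and `κ` is stationary, so the homotopy is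
  -- constantly `j ∘ f` there and descends. Its end map factors through the contractible space `X`.
  have h2 : u.Homotopic (G₁.comp k') :=
    homotopic_of_descends hp hps (fun z => G (κ z, z.2 * τ z.1)) (by fun_prop)
      (fun x x' s => key (fun x => G (κ (x, s), s * τ x)) (fun θ θ' e => by
        simp only [κa, hτa, mul_zero, hGa, H₀, e]) x x')
      _ _ (fun x => by simp [κ₀, hG0, hu]) (fun x => by simp [hGk, hk', G₁])
  obtain ⟨x₀, hx₀⟩ := id_nullhomotopic X
  have h3 : (G₁.comp k').Homotopic (ContinuousMap.const Y (G₁ x₀)) :=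
    (ContinuousMap.Homotopic.refl G₁).comp (hx₀.comp (ContinuousMap.Homotopic.refl k'))
  rw [contractible_iff_id_nullhomotopic]
  exact ⟨_, (h1.trans h2).trans h3⟩

/-! ### Open subsets of the disk do not embed in the line -/

/-- A continuous real function on a nonempty open subset of the closed disk is not injective. -/
theorem not_injOn_of_isOpen_closedBall
    {U : Set (Metric.closedBall (0 : EuclideanSpace ℝ (Fin 2)) 1)} (hU : IsOpen U)
    (hne : U.Nonempty) {g : Metric.closedBall (0 : EuclideanSpace ℝ (Fin 2)) 1 → ℝ}
    (hg : ContinuousOn g U) : ¬ InjOn g U := by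
  intro hinj
  obtain ⟨O, hO, rfl⟩ := isOpen_induced_iff.mp hU
  obtain ⟨⟨x, hx⟩, hxO⟩ := hne
  rw [← closure_ball _ one_ne_zero] at hx
  obtain ⟨c, hcO, hc⟩ := mem_closure_iff.mp hx O hO hxO
  obtain ⟨ε, hε, hball⟩ := Metric.isOpen_iff.mp (hO.inter Metric.isOpen_ball) c ⟨hcO, hc⟩
  have hmem : ∀ v ∈ Metric.sphere (0 : EuclideanSpace ℝ (Fin 2)) (ε / 2),
      c + v ∈ O ∩ Metric.ball 0 1 := by
    intro v hv
    apply hball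
    rw [mem_sphere_zero_iff_norm] at hv
    simp [hv]
    linarith
  have hcb : ∀ v ∈ Metric.sphere (0 : EuclideanSpace ℝ (Fin 2)) (ε / 2),
      c + v ∈ Metric.closedBall (0 : EuclideanSpace ℝ (Fin 2)) 1 :=
    fun v hv => Metric.ball_subset_closedBall (hmem v hv).2
  let S := Metric.sphere (0 : EuclideanSpace ℝ (Fin 2)) (ε / 2)
  have hrank : 1 < Module.rank ℝ (EuclideanSpace ℝ (Fin 2)) := by
    rw [← Module.finrank_eq_rank]
    simp
  have hS : IsConnected S := isConnected_sphere hrank 0 (by linarith)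
  have : ConnectedSpace S := isConnected_iff_connectedSpace.mp hS
  let G : S → ℝ := fun v => g ⟨c + v, hcb v v.2⟩
  have hG : Continuous G := by
    refine continuousOn_univ.mp (hg.comp (by fun_prop) ?_)
    intro v _
    exact (hmem v v.2).1
  have hGi : Function.Injective G := by
    intro v w e
    have := hinj (hmem v v.2).1 (hmem w w.2).1 e
    simpa [Subtype.ext_iff] using this
  -- Borsuk–Ulam on a small circle inside the open set: this odd function on a connected space has a
  -- zero, so two antipodal points have the same value.
  let F : S → ℝ := fun v => G v - G (-v)
  have hF : Continuous F := by fun_prop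
  obtain ⟨v₀, hv₀⟩ := hS.nonempty
  have hneg : F (-⟨v₀, hv₀⟩) = - F ⟨v₀, hv₀⟩ := by simp [F]
  have h0 : (0 : ℝ) ∈ range F := by
    rcases le_total (F ⟨v₀, hv₀⟩) 0 with h | h
    · exact mem_range_of_exists_le_of_exists_ge hF ⟨_, h⟩ ⟨_, by rw [hneg]; linarith⟩
    · exact mem_range_of_exists_le_of_exists_ge hF ⟨-⟨v₀, hv₀⟩, by rw [hneg]; linarith⟩ ⟨_, h⟩
  obtain ⟨v, hv⟩ := h0
  have hvv : v = -v := hGi (sub_eq_zero.mp hv)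
  have hv0 : (v : EuclideanSpace ℝ (Fin 2)) = 0 := by
    have := congrArg Subtype.val hvv
    rw [coe_neg_sphere] at this
    ext i
    have hi := congrArg (fun w => w.ofLp i) this
    simp only [PiLp.neg_apply, PiLp.zero_apply] at hi ⊢
    linarith
  have := v.2
  simp [hv0, S] at this
  linarith

/-! ### Deformation of a neighbourhood onto a subcomplex -/

section Faces

variable {V : Type*}

theorem mem_faces_of_subset (D : PreAbstractSimplicialComplex V) {s t : Finset V}
    (hs : s ∈ D.faces) (hts : t ⊆ s) (ht : t.Nonempty) : t ∈ D.faces :=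
  (D.isRelLowerSet_faces hs).2 hts ht

/-- The smallest coordinate on a finite set of vertices. -/
noncomputable def minCoord (s : Finset V) (x : V → ℝ) : ℝ :=
  -- The value `0` matters: the empty set is never a face, so it occurs in the sum defining `cutoff`
  -- and must contribute nothing.
  if h : s.Nonempty then s.inf' h x else 0

theorem continuous_minCoord (s : Finset V) : Continuous (minCoord s) := by
  unfold minCoord
  split_ifs with h
  · exact Continuous.finset_inf'_apply h fun v _ => continuous_apply v
  · exact continuous_const

theorem minCoord_nonneg (s : Finset V) {x : V → ℝ} (hx : ∀ v, 0 ≤ x v) : 0 ≤ minCoord s x := by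
  unfold minCoord
  split_ifs with h
  · exact Finset.le_inf' _ _ fun v _ => hx v
  · exact le_rfl

end Faces

section Realization

variable {V : Type*} [Fintype V]

theorem exists_pos_of_mem_stdSimplex {x : V → ℝ} (hx : x ∈ stdSimplex ℝ V) : ∃ v, 0 < x v := by
  by_contra! h
  have : ∑ v, x v ≤ 0 := Finset.sum_nonpos fun v _ => h v
  rw [hx.2] at this
  linarith

theorem supp_mem_faces {D : PreAbstractSimplicialComplex V} {x : V → ℝ}
    (hx : x ∈ realization D) : (Finset.univ.filter fun v => x v ≠ 0) ∈ D.faces := by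
  obtain ⟨hx, s, hs, h⟩ := hx
  refine mem_faces_of_subset D hs (fun v hv => h v (by simpa using hv)) ?_
  obtain ⟨v, hv⟩ := exists_pos_of_mem_stdSimplex hx
  exact ⟨v, by simpa using hv.ne'⟩

open Classical in
/-- A function that vanishes exactly on the subcomplex `A`. -/
noncomputable def cutoff (A : PreAbstractSimplicialComplex V) (x : V → ℝ) : ℝ :=
  ∑ s ∈ Finset.univ.filter (fun s => s ∉ A.faces), minCoord s x

theorem continuous_cutoff (A : PreAbstractSimplicialComplex V) : Continuous (cutoff A) :=
  continuous_finsetSum _ fun s _ => continuous_minCoord s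

theorem cutoff_nonneg (A : PreAbstractSimplicialComplex V) {x : V → ℝ} (hx : ∀ v, 0 ≤ x v) :
    0 ≤ cutoff A x :=
  Finset.sum_nonneg fun s _ => minCoord_nonneg s hx

theorem cutoff_eq_zero {A : PreAbstractSimplicialComplex V} {x : V → ℝ}
    (hx : x ∈ realization A) : cutoff A x = 0 := by
  classical
  refine Finset.sum_eq_zero fun s hs => le_antisymm ?_ (minCoord_nonneg s hx.1.1)
  unfold minCoord
  split_ifs with h
  · by_contra! hpos
    rw [Finset.lt_inf'_iff] at hpos
    simp only [Finset.mem_filter, Finset.mem_univ, true_and] at hs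
    refine hs (mem_faces_of_subset A (supp_mem_faces hx) (fun v hv => ?_) h)
    simpa using (hpos v hv).ne'
  · exact le_rfl

/-- If the superlevel set were not a face, its own smallest coordinate would be a summand of the
cutoff, although it exceeds the cutoff. Hence subtracting the cutoff leaves a point supported on
`A`. -/
theorem superlevel_mem_faces (A : PreAbstractSimplicialComplex V) {x : V → ℝ}
    (hx : ∀ v, 0 ≤ x v) (hne : ∃ v, cutoff A x < x v) :
    (Finset.univ.filter fun v => cutoff A x < x v) ∈ A.faces := by
  classical
  by_contra hs
  set s := Finset.univ.filter fun v => cutoff A x < x v with hs'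
  have hsne : s.Nonempty := by
    obtain ⟨v, hv⟩ := hne
    exact ⟨v, by simpa [hs'] using hv⟩
  have h1 : minCoord s x ≤ cutoff A x :=
    Finset.single_le_sum (f := fun s => minCoord s x)
      (fun t _ => minCoord_nonneg t hx) (by simpa using hs)
  have h2 : cutoff A x < minCoord s x := by
    unfold minCoord
    rw [dif_pos hsne, Finset.lt_inf'_iff]
    intro v hv
    simpa [hs'] using hv
  linarith

/-- Subtract the cutoff from every coordinate. -/
noncomputable def shrink (A : PreAbstractSimplicialComplex V) (x : V → ℝ) (v : V) : ℝ :=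
  max 0 (x v - cutoff A x)

/-- The total mass of `shrink`. -/
noncomputable def mass (A : PreAbstractSimplicialComplex V) (x : V → ℝ) : ℝ := ∑ v, shrink A x v

theorem continuous_shrink (A : PreAbstractSimplicialComplex V) (v : V) :
    Continuous fun x => shrink A x v := by
  have := continuous_cutoff A
  unfold shrink
  fun_prop

theorem continuous_mass (A : PreAbstractSimplicialComplex V) : Continuous (mass A) :=
  continuous_finsetSum _ fun v _ => continuous_shrink A v

theorem shrink_nonneg (A : PreAbstractSimplicialComplex V) (x : V → ℝ) (v : V) :
    0 ≤ shrink A x v := le_max_left _ _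

theorem shrink_eq_self {A : PreAbstractSimplicialComplex V} {x : V → ℝ}
    (hx : x ∈ realization A) : shrink A x = x := by
  ext v
  simp [shrink, cutoff_eq_zero hx, hx.1.1 v]

theorem mass_eq_one {A : PreAbstractSimplicialComplex V} {x : V → ℝ}
    (hx : x ∈ realization A) : mass A x = 1 := by
  rw [mass, shrink_eq_self hx, hx.1.2]

theorem shrink_eq_zero (A : PreAbstractSimplicialComplex V) {x : V → ℝ} (hx : ∀ v, 0 ≤ x v)
    {v : V} (hv : x v = 0) : shrink A x v = 0 := by
  have := cutoff_nonneg A hx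
  simp [shrink, hv, this]

/-- The unnormalized end map of the deformation onto the subcomplex `A`. -/
noncomputable def push (A : PreAbstractSimplicialComplex V) (x : V → ℝ) (v : V) : ℝ :=
  -- The correction keeps the total mass at least `1 / 2`, so normalization is continuous
  -- everywhere. It vanishes where `mass ≥ 1 / 2`, and there the result lies in `A`.
  shrink A x v + max 0 (1 / 2 - mass A x) * x v

theorem sum_push (A : PreAbstractSimplicialComplex V) {x : V → ℝ} (hx : x ∈ stdSimplex ℝ V) :
    ∑ v, push A x v = max (mass A x) (1 / 2) := by
  have hm : ∑ v, shrink A x v = mass A x := rfl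
  simp only [push, Finset.sum_add_distrib, ← Finset.mul_sum, hx.2, hm]
  rcases le_total (mass A x) (1 / 2) with h | h
  · rw [max_eq_right h, max_eq_right (by linarith)]
    ring
  · rw [max_eq_left h, max_eq_left (by linarith)]
    ring

/-- The end map of the deformation onto the subcomplex `A`. -/
noncomputable def pushNormalized (A : PreAbstractSimplicialComplex V) (x : V → ℝ) (v : V) : ℝ :=
  push A x v / max (mass A x) (1 / 2)

theorem max_mass_pos (A : PreAbstractSimplicialComplex V) (x : V → ℝ) :
    0 < max (mass A x) (1 / 2) := lt_max_of_lt_right (by norm_num)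

theorem continuous_pushNormalized (A : PreAbstractSimplicialComplex V) :
    Continuous (pushNormalized A) := by
  have h1 := continuous_shrink A
  have h2 := continuous_mass A
  unfold pushNormalized push
  refine continuous_pi fun v => Continuous.div ?_ (by fun_prop) fun x => (max_mass_pos A x).ne'
  have := h1 v
  fun_prop

theorem pushNormalized_mem_stdSimplex (A : PreAbstractSimplicialComplex V) {x : V → ℝ}
    (hx : x ∈ stdSimplex ℝ V) : pushNormalized A x ∈ stdSimplex ℝ V := by
  refine ⟨fun v => div_nonneg (add_nonneg (shrink_nonneg A x v)
    (mul_nonneg (le_max_left _ _) (hx.1 v))) (max_mass_pos A x).le, ?_⟩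
  simp only [pushNormalized]
  rw [← Finset.sum_div, sum_push A hx, div_self (max_mass_pos A x).ne']

theorem pushNormalized_eq_zero (A : PreAbstractSimplicialComplex V) {x : V → ℝ}
    (hx : ∀ v, 0 ≤ x v) {v : V} (hv : x v = 0) : pushNormalized A x v = 0 := by
  simp [pushNormalized, push, shrink_eq_zero A hx hv, hv]

theorem pushNormalized_eq_self {A : PreAbstractSimplicialComplex V} {x : V → ℝ}
    (hx : x ∈ realization A) : pushNormalized A x = x := by
  ext v
  simp only [pushNormalized, push, shrink_eq_self hx, mass_eq_one hx]
  norm_num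

theorem pushNormalized_mem (A : PreAbstractSimplicialComplex V) {x : V → ℝ}
    (hx : x ∈ stdSimplex ℝ V) (hm : 1 / 2 ≤ mass A x) : pushNormalized A x ∈ realization A := by
  have hlt : ∀ v, shrink A x v ≠ 0 → cutoff A x < x v := by
    intro v hv
    by_contra! h
    exact hv (max_eq_left (by linarith))
  refine ⟨pushNormalized_mem_stdSimplex A hx, _,
    superlevel_mem_faces A hx.1 ?_, fun v hv => ?_⟩
  · by_contra! h
    have : mass A x = 0 := Finset.sum_eq_zero fun v _ => by
      by_contra hv
      exact absurd (hlt v hv) (not_lt.mpr (h v))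
    linarith
  · simp only [Finset.mem_filter, Finset.mem_univ, true_and]
    refine hlt v fun h0 => hv ?_
    have : max 0 (1 / 2 - mass A x) = 0 := max_eq_left (by linarith)
    rw [pushNormalized, push, h0, this, zero_mul, add_zero, zero_div]

/-- The straight-line deformation towards the subcomplex `A`. -/
noncomputable def deform (D A : PreAbstractSimplicialComplex V)
    (z : realization D × unitInterval) : realization D :=
  ⟨(1 - (z.2 : ℝ)) • (z.1 : V → ℝ) + (z.2 : ℝ) • pushNormalized A z.1,
    convex_stdSimplex ℝ V z.1.2.1 (pushNormalized_mem_stdSimplex A z.1.2.1)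
      (sub_nonneg.mpr z.2.2.2) z.2.2.1 (by ring),
    -- The end map creates no new support, so the whole segment stays in the face carrying the
    -- starting point.
    z.1.2.2.choose, z.1.2.2.choose_spec.1, fun v hv => z.1.2.2.choose_spec.2 v fun h0 => hv (by
      simp [h0, pushNormalized_eq_zero A z.1.2.1.1 h0])⟩

theorem continuous_deform (D A : PreAbstractSimplicialComplex V) : Continuous (deform D A) := by
  have := continuous_pushNormalized A
  refine Continuous.subtype_mk ?_ _
  fun_prop

theorem compactSpace_realization (D : PreAbstractSimplicialComplex V) (hD : IsTriangulatedDisk D) :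
    CompactSpace (realization D) := by
  obtain ⟨e⟩ := hD.2
  have : CompactSpace (Metric.closedBall (0 : EuclideanSpace ℝ (Fin 2)) 1) :=
    isCompact_iff_compactSpace.mp (isCompact_closedBall _ _)
  exact e.symm.compactSpace

theorem contractibleSpace_realization (D : PreAbstractSimplicialComplex V)
    (hD : IsTriangulatedDisk D) : ContractibleSpace (realization D) := by
  obtain ⟨e⟩ := hD.2
  have := Metric.contractibleSpace_closedBall (x := (0 : EuclideanSpace ℝ (Fin 2))) zero_le_one
  exact e.contractibleSpace

/-- Every edge of a triangulated disk lies in a triangle. -/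
theorem exists_triangle_of_isEdge [DecidableEq V] {D : PreAbstractSimplicialComplex V}
    (hD : IsTriangulatedDisk D) {e : Finset V} (he : IsEdge D e) :
    ∃ t ∈ D.faces, t.card = 3 ∧ e ⊆ t := by
  by_contra! hno
  obtain ⟨u, v, huv, rfl⟩ := Finset.card_eq_two.mp he.2
  obtain ⟨φ⟩ := hD.2
  -- the open edge
  let O : Set (realization D) := {x | 0 < x.1 u ∧ 0 < x.1 v}
  have hO : IsOpen O := by
    have hw : ∀ w, IsOpen {x : realization D | 0 < x.1 w} := fun w =>
      isOpen_lt continuous_const ((continuous_apply w).comp continuous_subtype_val)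
    exact (hw u).inter (hw v)
  have hsupp : ∀ x ∈ O, ∀ w, w ≠ u → w ≠ v → x.1 w = 0 := by
    intro x hx w hwu hwv
    by_contra hw
    have hs := supp_mem_faces x.2
    have hsub : ({u, v, w} : Finset V) ⊆ Finset.univ.filter fun v => x.1 v ≠ 0 := by
      intro y hy
      simp only [Finset.mem_insert, Finset.mem_singleton] at hy
      simp only [Finset.mem_filter, Finset.mem_univ, true_and]
      rcases hy with rfl | rfl | rfl
      · exact hx.1.ne'
      · exact hx.2.ne'
      · exact hw
    refine hno {u, v, w} (mem_faces_of_subset D hs hsub ⟨u, by simp⟩) ?_ ?_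
    · exact Finset.card_eq_three.mpr ⟨u, v, w, huv, hwu.symm, hwv.symm, rfl⟩
    · intro y hy
      simp only [Finset.mem_insert, Finset.mem_singleton] at hy ⊢
      tauto
  have hsum : ∀ x ∈ O, x.1 u + x.1 v = 1 := by
    intro x hx
    rw [← x.2.1.2, ← Finset.sum_pair huv]
    refine Finset.sum_subset (Finset.subset_univ _) fun w _ hw => ?_
    simp only [Finset.mem_insert, Finset.mem_singleton, not_or] at hw
    exact hsupp x hx w hw.1 hw.2
  have hinj : InjOn (fun x : realization D => x.1 u) O := by
    intro x hx y hy h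
    ext w
    by_cases hwu : w = u
    · subst hwu; exact h
    by_cases hwv : w = v
    · subst hwv
      have h1 := hsum x hx
      have h2 := hsum y hy
      simp only at h
      linarith
    · rw [hsupp x hx w hwu hwv, hsupp y hy w hwu hwv]
  have hmid : ((1 / 2 : ℝ) • (Pi.single u 1 : V → ℝ) + (1 / 2 : ℝ) • Pi.single v 1)
      ∈ realization D := by
    refine ⟨convex_stdSimplex ℝ V (single_mem_stdSimplex ℝ u) (single_mem_stdSimplex ℝ v)
      (by norm_num) (by norm_num) (by norm_num), {u, v}, he.1, fun w hw => ?_⟩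
    by_contra hw'
    simp only [Finset.mem_insert, Finset.mem_singleton, not_or] at hw'
    simp [hw'.1, hw'.2] at hw
  refine not_injOn_of_isOpen_closedBall (U := φ.symm ⁻¹' O) (hO.preimage φ.symm.continuous)
    ⟨φ ⟨_, hmid⟩, ?_⟩ (g := fun z => (φ.symm z).1 u) ?_ ?_
  · simp [O, huv, huv.symm]
  · have : Continuous fun z => (φ.symm z).1 u :=
      (continuous_apply u).comp (continuous_subtype_val.comp φ.symm.continuous)
    exact this.continuousOn
  · exact fun x hx y hy h => φ.symm.injective (hinj hx hy h)

end Realization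

/-! ### Degree of the boundary walk -/

theorem zmod_eq_of_forall_succ {n : ℕ} {α : Type*} (f : ZMod n → α)
    (hf : ∀ k, f (k + 1) = f k) (k : ZMod n) : f k = f 0 := by
  obtain ⟨z, rfl⟩ := ZMod.intCast_surjective k
  induction z using Int.induction_on with
  | zero => simp
  | succ i ih => rw [← ih]; push_cast; exact hf _
  | pred i ih => rw [← ih, ← hf]; push_cast; congr 1; ring

theorem exists_int_antiderivative (ε : ℤ → ℤ) (a : ℤ) :
    ∃ Φ : ℤ → ℤ, Φ 0 = a ∧ ∀ i, Φ (i + 1) = Φ i + ε i := by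
  refine ⟨fun i => Int.inductionOn' (motive := fun _ => ℤ) i 0 a (fun k _ x => x + ε k)
    (fun k _ x => x - ε (k - 1)), Int.inductionOn'_self .., fun i => ?_⟩
  rcases le_or_gt 0 i with hi | hi
  · exact Int.inductionOn'_add_one hi
  · have h := Int.inductionOn'_sub_one (motive := fun _ => ℤ) (b := 0) (z := i + 1) (zero := a)
      (succ := fun k _ x => x + ε k) (pred := fun k _ x => x - ε (k - 1)) (by lia)
    simp only [add_sub_cancel_right] at h
    simp only [h]
    ring

theorem sum_zmod_eq_sum_range {m : ℕ} [NeZero m] (f : ZMod m → ℤ) :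
    ∑ i, f i = ∑ i ∈ Finset.range m, f i := by
  symm
  refine Finset.sum_bij (fun i _ => (i : ZMod m)) (fun _ _ => Finset.mem_univ _) ?_ ?_
    (fun _ _ => rfl)
  · intro i hi j hj hij
    have := (ZMod.natCast_eq_natCast_iff' _ _ _).mp hij
    rwa [Nat.mod_eq_of_lt (Finset.mem_range.mp hi), Nat.mod_eq_of_lt (Finset.mem_range.mp hj)]
      at this
  · intro i _
    exact ⟨i.val, Finset.mem_range.mpr (ZMod.val_lt i), by simp⟩

/-- A closed walk on a cycle that visits every vertex three times, and runs through every edge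
twice in one direction and once in the other, has degree one or minus one. -/
theorem exists_lift_of_walk {m n : ℕ} (hm : 3 ≤ m) (hn : 3 ≤ n) (φ : ZMod m → ZMod n)
    (step : ∀ i, φ (i + 1) = φ i + 1 ∨ φ i = φ (i + 1) + 1)
    (fib : ∀ k, {i | φ i = k}.ncard = 3)
    (orient : ∀ k, ({i | φ i = k ∧ φ (i + 1) = k + 1}.ncard = 2 ∧
        {i | φ i = k + 1 ∧ φ (i + 1) = k}.ncard = 1) ∨
      ({i | φ i = k ∧ φ (i + 1) = k + 1}.ncard = 1 ∧
        {i | φ i = k + 1 ∧ φ (i + 1) = k}.ncard = 2)) :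
    m = 3 * n ∧ ∃ (δ : ℤ) (Φ : ℤ → ℤ), (δ = 1 ∨ δ = -1) ∧ (∀ i : ℤ, (Φ i : ZMod n) = φ i) ∧
      (∀ i, Φ (i + 1) = Φ i + 1 ∨ Φ (i + 1) = Φ i - 1) ∧ ∀ i, Φ (i + m) = Φ i + δ * n := by
  classical
  have : NeZero m := ⟨by lia⟩
  have : NeZero n := ⟨by lia⟩
  have h2 : (2 : ZMod n) ≠ 0 := by
    intro h
    have := (ZMod.natCast_eq_zero_iff 2 n).mp (by exact_mod_cast h)
    have := Nat.le_of_dvd (by norm_num) this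
    lia
  simp only [Set.ncard_eq_toFinset_card', Set.toFinset_ofPred] at fib orient
  set P : ZMod n → ℕ := fun k => (Finset.univ.filter fun i => φ i = k ∧ φ (i + 1) = k + 1).card
    with hP
  set N : ZMod n → ℕ := fun k => (Finset.univ.filter fun i => φ i = k + 1 ∧ φ (i + 1) = k).card
    with hN
  have horient : ∀ k, (P k = 2 ∧ N k = 1) ∨ (P k = 1 ∧ N k = 2) := orient
  have hpos : ∀ k, ((Finset.univ.filter fun i => φ i = k).filter
      fun i => φ (i + 1) = φ i + 1).card = P k := by
    intro k
    rw [Finset.filter_filter]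
    congr 1
    ext i
    simp only [Finset.mem_filter, Finset.mem_univ, true_and]
    constructor <;> rintro ⟨rfl, h⟩ <;> exact ⟨rfl, h⟩
  have hneg : ∀ k, ((Finset.univ.filter fun i => φ i = k + 1).filter
      fun i => ¬ φ (i + 1) = φ i + 1).card = N k := by
    intro k
    rw [Finset.filter_filter]
    congr 1
    ext i
    simp only [Finset.mem_filter, Finset.mem_univ, true_and]
    constructor
    · rintro ⟨h1, h⟩
      refine ⟨h1, ?_⟩
      rcases step i with h' | h'
      · exact absurd h' h
      · rw [h1] at h'
        exact (add_right_cancel h').symm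
    · rintro ⟨h1, h⟩
      refine ⟨h1, fun h' => h2 ?_⟩
      rw [h1, h] at h'
      linear_combination -h'
  -- Each of the three visits to `k + 1` leaves either forwards along the next edge or backwards
  -- along the previous one. With `P (k + 1) + N (k + 1) = 3` this makes `N` constant.
  have hout : ∀ k, P (k + 1) + N k = 3 := by
    intro k
    rw [← fib (k + 1), ← hpos, ← hneg, Finset.card_filter_add_card_filter_not]
  have hconst : ∀ k, N k = N 0 := by
    refine zmod_eq_of_forall_succ N fun k => ?_
    have h1 := hout k
    have h2 := horient (k + 1)
    lia
  have hcard : m = 3 * n := by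
    have h := Finset.card_eq_sum_card_fiberwise (f := φ) (s := Finset.univ) (t := Finset.univ)
      (by simp)
    simp only [fib] at h
    simpa [ZMod.card, mul_comm] using h
  refine ⟨hcard, ?_⟩
  set ε : ZMod m → ℤ := fun i => if φ (i + 1) = φ i + 1 then 1 else -1 with hε
  -- Net number of forward departures from any vertex, `(3 - N) - N`; it is `±1` since `N` is `1` or
  -- `2`.
  set δ : ℤ := 3 - 2 * N 0 with hδ
  have hsumfib : ∀ k, ∑ i ∈ Finset.univ.filter (fun i => φ i = k + 1), ε i = δ := by
    intro k
    simp only [hε]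
    rw [Finset.sum_ite]
    simp only [Finset.sum_const, hpos, hneg, nsmul_eq_mul]
    have h1 := hout k
    have h2 := hconst k
    lia
  have hsum : ∑ i, ε i = δ * n := by
    rw [← Finset.sum_fiberwise (s := Finset.univ) (g := φ)]
    have : ∀ k, ∑ i ∈ Finset.univ.filter (fun i => φ i = k), ε i = δ := by
      intro k
      have := hsumfib (k - 1)
      rwa [sub_add_cancel] at this
    simp [this, ZMod.card, mul_comm]
  obtain ⟨z, hz⟩ := ZMod.intCast_surjective (φ 0)
  obtain ⟨Φ, hΦ0, hΦ⟩ := exists_int_antiderivative (fun i => ε i) z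
  have hεφ : ∀ i, φ (i + 1) = φ i + ε i := by
    intro i
    simp only [hε]
    split_ifs with h
    · simpa using h
    · have := (step i).resolve_left h
      rw [this]
      push_cast
      ring
  have hεcases : ∀ i, ε i = 1 ∨ ε i = -1 := by
    intro i
    simp only [hε]
    split_ifs <;> simp
  refine ⟨δ, Φ, ?_, ?_, ?_, ?_⟩
  · have := horient 0
    lia
  · intro i
    induction i using Int.induction_on with
    | zero => simp [hΦ0, hz]
    | succ i ih =>
      rw [hΦ, Int.cast_add, ih]
      push_cast
      rw [hεφ]
    | pred i ih =>
      have h1 := hΦ (-i - 1)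
      have h2 := hεφ ((-i - 1 : ℤ) : ZMod m)
      rw [sub_add_cancel] at h1
      rw [h1, Int.cast_add] at ih
      have h3 : (((-i - 1 : ℤ) : ZMod m) + 1) = ((-i : ℤ) : ZMod m) := by push_cast; ring
      rw [h3, ← ih] at h2
      exact add_right_cancel h2
  · intro i
    have h1 := hΦ i
    rcases hεcases i with h | h <;> rw [h] at h1
    · exact Or.inl h1
    · exact Or.inr h1
  -- The increments depend only on `i` modulo `m`, so the displacement over one turn is independent
  -- of the start and equals the sum of all increments.
  · have hshift : ∀ i, Φ (i + m) - Φ i = Φ (0 + m) - Φ 0 := by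
      intro i
      induction i using Int.induction_on with
      | zero => rfl
      | succ i ih =>
        rw [← ih, add_right_comm, hΦ, hΦ]
        push_cast
        simp
      | pred i ih =>
        have h1 := hΦ (-i - 1)
        have h2 := hΦ (-i - 1 + m)
        rw [← ih]
        rw [sub_add_cancel] at h1
        rw [show (-i - 1 + m + 1 : ℤ) = -i + m by ring] at h2
        rw [h1, h2]
        push_cast
        simp
    have hr : ∀ k : ℕ, Φ k = Φ 0 + ∑ i ∈ Finset.range k, ε i := by
      intro k
      induction k with
      | zero => simp
      | succ k ih =>
        push_cast
        rw [hΦ, ih, Finset.sum_range_succ]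
        push_cast
        ring
    intro i
    have h1 := hshift i
    rw [zero_add, hr m, ← sum_zmod_eq_sum_range, hsum] at h1
    linarith

/-! ### Piecewise linear interpolation -/

section Interpolation

variable {E F : Type*} [AddCommGroup E] [Module ℝ E] [AddCommGroup F] [Module ℝ F]

/-- Piecewise linear interpolation of a sequence indexed by the integers. -/
noncomputable def interp (f : ℤ → E) (t : ℝ) : E :=
  (1 - Int.fract t) • f ⌊t⌋ + Int.fract t • f (⌊t⌋ + 1)

/-- Allowing `r = 1` lets adjacent pieces be glued and lets an edge be run through backwards, with
parameter `1 - fract t`. -/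
theorem interp_intCast_add (f : ℤ → E) (i : ℤ) {r : ℝ} (h0 : 0 ≤ r) (h1 : r ≤ 1) :
    interp f (i + r) = (1 - r) • f i + r • f (i + 1) := by
  rcases h1.lt_or_eq with h1 | rfl
  · have hr : ⌊r⌋ = 0 := Int.floor_eq_zero_iff.mpr ⟨h0, h1⟩
    have hf : Int.fract r = r := Int.fract_eq_self.mpr ⟨h0, h1⟩
    simp [interp, hr, hf]
  · have : (i : ℝ) + 1 = ((i + 1 : ℤ) : ℝ) := by push_cast; rfl
    rw [this]
    simp [interp]

theorem interp_eq (f : ℤ → E) (i : ℤ) {t : ℝ} (ht : t ∈ Icc (i : ℝ) (i + 1)) :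
    interp f t = (1 - (t - i)) • f i + (t - i) • f (i + 1) := by
  have := interp_intCast_add f i (r := t - i) (by linarith [ht.1]) (by linarith [ht.2])
  rwa [add_sub_cancel] at this

theorem continuous_interp [TopologicalSpace E] [ContinuousAdd E] [ContinuousSMul ℝ E]
    (f : ℤ → E) : Continuous (interp f) := by
  have hl : LocallyFinite fun i : ℤ => Icc (i : ℝ) (i + 1) := by
    intro x
    refine ⟨Ioo (x - 1) (x + 1), Ioo_mem_nhds (by linarith) (by linarith),
      (finite_Icc (⌊x⌋ - 2) (⌊x⌋ + 2)).subset ?_⟩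
    rintro i ⟨y, ⟨hy1, hy2⟩, hy3, hy4⟩
    have h1 := Int.floor_le x
    have h2 := Int.lt_floor_add_one x
    constructor
    · have : ((⌊x⌋ - 2 : ℤ) : ℝ) ≤ i := by push_cast; linarith
      exact_mod_cast this
    · have : (i : ℝ) ≤ ((⌊x⌋ + 2 : ℤ) : ℝ) := by push_cast; linarith
      exact_mod_cast this
  refine hl.continuous ?_ (fun i => isClosed_Icc) fun i => ?_
  · refine eq_univ_of_forall fun x => mem_iUnion.mpr ⟨⌊x⌋, Int.floor_le x, ?_⟩
    exact (Int.lt_floor_add_one x).le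
  · refine ContinuousOn.congr (f := fun t : ℝ => (1 - (t - i)) • f i + (t - i) • f (i + 1)) ?_
      fun t ht => interp_eq f i ht
    fun_prop

theorem interp_add_natCast {f : ℤ → E} {m : ℕ} {a : E} (hf : ∀ i, f (i + m) = f i + a) (t : ℝ) :
    interp f (t + m) = interp f t + a := by
  simp only [interp, Int.floor_add_natCast, Int.fract_add_natCast, add_right_comm _ (m : ℤ), hf]
  module

theorem map_interp (L : E →ₗ[ℝ] F) (f : ℤ → E) (t : ℝ) :
    L (interp f t) = interp (fun i => L (f i)) t := by
  simp [interp]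

/-- Unit steps of `Φ` send each unit interval affinely onto a unit interval with integer endpoints,
on which interpolation of `g` is affine. For larger steps this would fail. -/
theorem interp_interp (g : ℤ → E) {Φ : ℤ → ℤ}
    (hΦ : ∀ i, Φ (i + 1) = Φ i + 1 ∨ Φ (i + 1) = Φ i - 1) (t : ℝ) :
    interp g (interp (fun i => (Φ i : ℝ)) t) = interp (fun i => g (Φ i)) t := by
  have h0 := Int.fract_nonneg t
  have h1 := (Int.fract_lt_one t).le
  rcases hΦ ⌊t⌋ with h | h
  · have : interp (fun i => (Φ i : ℝ)) t = (Φ ⌊t⌋ : ℤ) + Int.fract t := by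
      simp only [interp, h, smul_eq_mul]
      push_cast
      ring
    rw [this, interp_intCast_add _ _ h0 h1, ← h]
    rfl
  · have : interp (fun i => (Φ i : ℝ)) t = (Φ ⌊t⌋ - 1 : ℤ) + (1 - Int.fract t) := by
      simp only [interp, h, smul_eq_mul]
      push_cast
      ring
    rw [this, interp_intCast_add _ _ (by linarith) (by linarith), ← h, interp]
    rw [h, sub_add_cancel, sub_sub_cancel, add_comm]

end Interpolation

/-! ### Polygons as circles, and the homotopy class of the boundary map -/

section Cycle

variable {V : Type*} [DecidableEq V] {m : ℕ}

/-- The one-dimensional complex of a cyclic sequence of vertices. -/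
def cycleComplex (b : ZMod m → V) : PreAbstractSimplicialComplex V where
  faces := {s | s.Nonempty ∧ ∃ i, s ⊆ {b i, b (i + 1)}}
  isRelLowerSet_faces := by
    rintro s ⟨hs, i, hi⟩
    exact ⟨hs, fun t hts ht => ⟨ht, i, hts.trans hi⟩⟩

/-- The closed polygonal path through a cyclic sequence of vertices. -/
noncomputable def polygonPath (b : ZMod m → V) (t : ℝ) : V → ℝ :=
  interp (fun i : ℤ => Pi.single (b i) 1) t

theorem continuous_polygonPath (b : ZMod m → V) : Continuous (polygonPath b) :=
  continuous_interp fun i : ℤ => (Pi.single (b i) 1 : V → ℝ)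

theorem periodic_polygonPath (b : ZMod m → V) : Function.Periodic (polygonPath b) (m : ℝ) := by
  intro t
  have := interp_add_natCast (m := m) (f := fun i : ℤ => (Pi.single (b i) 1 : V → ℝ)) (a := 0)
    (by simp) t
  simpa [polygonPath] using this

theorem polygonPath_apply {b : ZMod m → V} (hb : Function.Injective b) (t : ℝ) (k : ZMod m) :
    polygonPath b t (b k) = (1 - Int.fract t) * (if k = ⌊t⌋ then 1 else 0) +
      Int.fract t * (if k = ⌊t⌋ + 1 then 1 else 0) := by
  simp [polygonPath, interp, Pi.single_apply, hb.eq_iff]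

theorem range_polygonPath [Fintype V] {b : ZMod m → V} (hb : Function.Injective b)
    (hm : 3 ≤ m) : range (polygonPath b) = realization (cycleComplex b) := by
  have hm1 : Fact (1 < m) := ⟨by lia⟩
  ext x
  constructor
  · rintro ⟨t, rfl⟩
    refine ⟨convex_stdSimplex ℝ V (single_mem_stdSimplex ℝ _) (single_mem_stdSimplex ℝ _)
      (by linarith [Int.fract_lt_one t]) (Int.fract_nonneg t) (by ring),
      {b ⌊t⌋, b (⌊t⌋ + 1)}, ⟨⟨b ⌊t⌋, by simp⟩, ⌊t⌋, le_rfl⟩, fun v hv => ?_⟩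
    by_contra hv'
    simp only [Finset.mem_insert, Finset.mem_singleton, not_or] at hv'
    exact hv (by simp [polygonPath, interp, hv'.1, hv'.2])
  · rintro ⟨hx, s, ⟨-, i, hi⟩, hs⟩
    obtain ⟨z, rfl⟩ := ZMod.intCast_surjective i
    have hne : b z ≠ b (z + 1) := fun h => by simpa using hb h
    have h0 : ∀ v, v ≠ b z → v ≠ b (z + 1) → x v = 0 := by
      intro v h1 h2
      by_contra hv
      have := hi (hs v hv)
      simp [h1, h2] at this
    have hsum : x (b z) + x (b (z + 1)) = 1 := by
      rw [← hx.2, ← Finset.sum_pair hne]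
      refine Finset.sum_subset (Finset.subset_univ _) fun w _ hw => ?_
      simp only [Finset.mem_insert, Finset.mem_singleton, not_or] at hw
      exact h0 w hw.1 hw.2
    have hp := hx.1 (b z)
    refine ⟨z + x (b (z + 1)), ?_⟩
    rw [polygonPath, interp_intCast_add _ _ (hx.1 _) (by linarith)]
    ext v
    by_cases h1 : v = b z
    · subst h1
      simp [hne]
      linarith
    by_cases h2 : v = b (z + 1)
    · subst h2
      simp [hne.symm]
    · simp [h1, h2, h0 v h1 h2]

theorem coe_eq_of_polygonPath_eq {b : ZMod m → V} (hb : Function.Injective b) (hm : 3 ≤ m)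
    {t t' : ℝ} (h : polygonPath b t = polygonPath b t') :
    (t : AddCircle (m : ℝ)) = t' := by
  have hm1 : Fact (1 < m) := ⟨by lia⟩
  have h2 : (2 : ZMod m) ≠ 0 := by
    intro h
    have := (ZMod.natCast_eq_zero_iff 2 m).mp (by exact_mod_cast h)
    have := Nat.le_of_dvd (by norm_num) this
    lia
  have hE : ∀ k : ZMod m, _ := fun k => (polygonPath_apply hb t k).symm.trans
    ((congrFun h (b k)).trans (polygonPath_apply hb t' k))
  have h1 := Int.fract_lt_one t
  have h1' := Int.fract_lt_one t'
  -- The coordinate at `⌊t⌋` is positive, so distinct floors would each have to be the successor of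
  -- the other, forcing `2 = 0` modulo `m`.
  have hfl : (⌊t⌋ : ZMod m) = ⌊t'⌋ := by
    by_contra hne
    have e1 := hE ⌊t⌋
    have e2 := hE ⌊t'⌋
    by_cases e3 : (⌊t⌋ : ZMod m) = ⌊t'⌋ + 1
    · by_cases e4 : (⌊t'⌋ : ZMod m) = ⌊t⌋ + 1
      · refine h2 ?_
        linear_combination -e3 - e4
      · simp [Ne.symm hne, e4] at e2
        linarith
    · simp [hne, e3] at e1
      linarith
  have hfr : Int.fract t = Int.fract t' := by
    have e1 := hE (⌊t⌋ + 1)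
    rw [hfl] at e1
    simpa using e1
  obtain ⟨k, hk⟩ := (ZMod.intCast_eq_intCast_iff_dvd_sub _ _ _).mp hfl
  rw [← sub_eq_zero, ← AddCircle.coe_sub, AddCircle.coe_eq_zero_iff]
  refine ⟨-k, ?_⟩
  have hk' : (⌊t'⌋ : ℝ) - ⌊t⌋ = m * k := by exact_mod_cast hk
  rw [← Int.floor_add_fract t, ← Int.floor_add_fract t', hfr]
  simp only [zsmul_eq_mul]
  push_cast
  linarith

/-- The embedding of a circle as the polygon of a cyclic sequence of vertices. -/
noncomputable def polygonMap (b : ZMod m → V) : AddCircle (m : ℝ) → V → ℝ :=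
  (periodic_polygonPath b).lift

theorem polygonMap_coe (b : ZMod m → V) (t : ℝ) : polygonMap b t = polygonPath b t := rfl

theorem continuous_polygonMap (b : ZMod m → V) : Continuous (polygonMap b) :=
  continuous_coinduced_dom.mpr (continuous_polygonPath b)

theorem polygonMap_injective {b : ZMod m → V} (hb : Function.Injective b) (hm : 3 ≤ m) :
    Function.Injective (polygonMap b) := by
  intro x y h
  obtain ⟨t, rfl⟩ := QuotientAddGroup.mk_surjective x
  obtain ⟨t', rfl⟩ := QuotientAddGroup.mk_surjective y
  exact coe_eq_of_polygonPath_eq hb hm h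

theorem range_polygonMap [Fintype V] {b : ZMod m → V} (hb : Function.Injective b)
    (hm : 3 ≤ m) : range (polygonMap b) = realization (cycleComplex b) := by
  rw [← range_polygonPath hb hm]
  refine Subset.antisymm ?_ ?_
  · rintro _ ⟨x, rfl⟩
    obtain ⟨t, rfl⟩ := QuotientAddGroup.mk_surjective x
    exact ⟨t, rfl⟩
  · rintro _ ⟨t, rfl⟩
    exact ⟨t, rfl⟩

end Cycle

/-- The map between circles induced by the interpolation of a sequence with quasi-period
`(m, ± n)` is homotopic to a homeomorphism. -/
theorem exists_homotopy_homeomorph {m n : ℕ} (hm : 0 < m) (hn : 0 < n) {δ : ℤ}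
    (hδ : δ = 1 ∨ δ = -1) {Φ : ℤ → ℤ} (hΦ : ∀ i, Φ (i + m) = Φ i + δ * n) :
    ∃ (h : AddCircle (m : ℝ) ≃ₜ AddCircle (n : ℝ))
      (H : AddCircle (m : ℝ) × ℝ → AddCircle (n : ℝ)),
      Continuous H ∧ (∀ t : ℝ, H ((t : AddCircle (m : ℝ)), 0) =
        (interp (fun i => (Φ i : ℝ)) t : ℝ)) ∧ ∀ θ, H (θ, 1) = h θ := by
  have hm' : (m : ℝ) ≠ 0 := by positivity
  have hn' : (n : ℝ) ≠ 0 := by positivity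
  obtain ⟨h, hh⟩ : ∃ h : AddCircle (m : ℝ) ≃ₜ AddCircle (n : ℝ),
      ∀ t : ℝ, h t = ((δ * n / m * t : ℝ) : AddCircle (n : ℝ)) := by
    let h₀ := AddCircle.homeomorphAddCircle (m : ℝ) (n : ℝ) hm' hn'
    rcases hδ with rfl | rfl
    · refine ⟨h₀, fun t => ?_⟩
      rw [AddCircle.homeomorphAddCircle_apply_mk]
      congr 1
      push_cast
      field_simp
    · refine ⟨h₀.trans (Homeomorph.neg _), fun t => ?_⟩
      rw [Homeomorph.trans_apply, AddCircle.homeomorphAddCircle_apply_mk]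
      simp only [Homeomorph.coe_neg]
      rw [← AddCircle.coe_neg]
      congr 1
      push_cast
      field_simp
  -- Subtracting the linear function of the same degree leaves a real-valued periodic function,
  -- which can be scaled to zero.
  have hper : Function.Periodic
      (fun t : ℝ => interp (fun i => (Φ i : ℝ)) t - δ * n / m * t) (m : ℝ) := by
    intro t
    have := interp_add_natCast (f := fun i => (Φ i : ℝ)) (m := m) (a := (δ * n : ℝ))
      (fun i => by rw [hΦ]; push_cast; rfl) t
    simp only [this]
    field_simp
    ring
  have hc : Continuous hper.lift :=
    continuous_coinduced_dom.mpr ((continuous_interp _).sub (continuous_const_mul _))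
  refine ⟨h, fun z => h z.1 + (((1 - z.2) * hper.lift z.1 : ℝ) : AddCircle (n : ℝ)), ?_, ?_, ?_⟩
  · have h1 : Continuous ((↑) : ℝ → AddCircle (n : ℝ)) := AddCircle.continuous_mk' _
    have h2 := h.continuous
    fun_prop
  · intro t
    simp only [hh, Function.Periodic.lift_coe]
    rw [← AddCircle.coe_add]
    congr 1
    ring
  · intro θ
    simp

theorem exists_corresponding {V W : Type*} [DecidableEq W] {q : V → W} {s t : Finset V}
    (hst : s.image q = t.image q) {v : V} (hv : v ∈ s) : ∃ w ∈ t, q v = q w := by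
  obtain ⟨w, hw, e⟩ := Finset.mem_image.mp (hst ▸ Finset.mem_image_of_mem q hv)
  exact ⟨w, hw, e.symm⟩

/-! ### Combinatorics of the identification; absence of free faces -/

section Identification

variable {V W : Type*} [Fintype V] [DecidableEq V] [DecidableEq W]
  {D : PreAbstractSimplicialComplex V} {m : ℕ} {b : ZMod m → V} {q : V → W}
  {K : PreAbstractSimplicialComplex W} {n : ℕ} {c : ZMod n → W}

namespace IsSawBladeIdentification

theorem isBoundaryEdge_pair (h : IsSawBladeIdentification D b q K c) (i : ZMod m) :
    IsBoundaryEdge D {b i, b (i + 1)} :=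
  (h.boundary.2.2 _).mpr ⟨i, rfl⟩

theorem ne_succ (h : IsSawBladeIdentification D b q K c) (i : ZMod m) : b i ≠ b (i + 1) := by
  intro e
  have := (h.isBoundaryEdge_pair i).1.2
  simp [e] at this

theorem image_ne_succ (h : IsSawBladeIdentification D b q K c) (i : ZMod m) :
    q (b i) ≠ q (b (i + 1)) := fun e =>
  h.ne_succ i (h.nondegenerate _ (h.isBoundaryEdge_pair i).1.1 (by simp) (by simp) e)

theorem pair_mem_faces (h : IsSawBladeIdentification D b q K c) (k : ZMod n) :
    {c k, c (k + 1)} ∈ K.faces := by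
  obtain ⟨i, hi⟩ := (h.cycle _).mpr ⟨k, rfl⟩
  rw [hi, h.image_eq]
  exact ⟨_, (h.isBoundaryEdge_pair i).1.1, by simp [Finset.image_insert]⟩

/-- The identified boundary of the disk is a closed walk on the cycle. -/
theorem exists_walk (h : IsSawBladeIdentification D b q K c) :
    ∃ φ : ZMod m → ZMod n, (∀ i, q (b i) = c (φ i)) ∧
      (∀ i, φ (i + 1) = φ i + 1 ∨ φ i = φ (i + 1) + 1) ∧
      (∀ k, {i | φ i = k}.ncard = 3) ∧
      ∀ k, ({i | φ i = k ∧ φ (i + 1) = k + 1}.ncard = 2 ∧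
          {i | φ i = k + 1 ∧ φ (i + 1) = k}.ncard = 1) ∨
        ({i | φ i = k ∧ φ (i + 1) = k + 1}.ncard = 1 ∧
          {i | φ i = k + 1 ∧ φ (i + 1) = k}.ncard = 2) := by
  have hex : ∀ i, ∃ k, q (b i) = c k := by
    intro i
    obtain ⟨k, hk⟩ := (h.cycle _).mp ⟨i, rfl⟩
    have : q (b i) ∈ ({c k, c (k + 1)} : Finset W) := by rw [← hk]; simp
    simp only [Finset.mem_insert, Finset.mem_singleton] at this
    rcases this with e | e
    exacts [⟨_, e⟩, ⟨_, e⟩]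
  choose φ hφ using hex
  have hinj := h.cycle_injective
  refine ⟨φ, hφ, fun i => ?_, fun k => ?_, fun k => ?_⟩
  · obtain ⟨k, hk⟩ := (h.cycle _).mp ⟨i, rfl⟩
    have h1 : q (b i) ∈ ({c k, c (k + 1)} : Finset W) := by rw [← hk]; simp
    have h2 : q (b (i + 1)) ∈ ({c k, c (k + 1)} : Finset W) := by rw [← hk]; simp
    have h3 := h.image_ne_succ i
    simp only [Finset.mem_insert, Finset.mem_singleton, hφ, hinj.eq_iff, ne_eq] at h1 h2 h3
    rcases h1 with h1 | h1 <;> rcases h2 with h2 | h2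
    · exact absurd (h1.trans h2.symm) h3
    · left; rw [h1, h2]
    · right; rw [h1, h2]
    · exact absurd (h1.trans h2.symm) h3
  · obtain ⟨i, hi⟩ : ∃ i, φ i = k := by
      obtain ⟨i, hi⟩ := (h.cycle _).mpr ⟨k, rfl⟩
      have : c k ∈ ({q (b i), q (b (i + 1))} : Finset W) := by rw [← hi]; simp
      simp only [Finset.mem_insert, Finset.mem_singleton, hφ, hinj.eq_iff] at this
      rcases this with e | e
      exacts [⟨_, e.symm⟩, ⟨_, e.symm⟩]
    have := h.vertices_three i
    simpa only [hφ, hinj.eq_iff, hi] using this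
  · have := h.orientation k
    simpa only [hφ, hinj.eq_iff] using this

theorem eq_three_mul (h : IsSawBladeIdentification D b q K c) : m = 3 * n := by
  obtain ⟨φ, -, h1, h2, h3⟩ := h.exists_walk
  exact (exists_lift_of_walk h.boundary.1 h.three_le φ h1 h2 h3).1

/-- The boundary length is `m = 3 * n ≥ 9`; this excludes short boundary cycles. -/
theorem natCast_ne_zero (h : IsSawBladeIdentification D b q K c) {a : ℕ} (ha : 0 < a)
    (ha' : a < 9) : (a : ZMod m) ≠ 0 := by
  intro e
  have h1 := Nat.le_of_dvd ha ((ZMod.natCast_eq_zero_iff a m).mp e)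
  have h2 := h.eq_three_mul
  have h3 := h.three_le
  lia

/-- The neighbours on the boundary cycle of a boundary vertex. -/
theorem exists_index_of_isBoundaryEdge (h : IsSawBladeIdentification D b q K c) {u v : V}
    (huv : IsBoundaryEdge D {u, v}) : ∃ i, u = b i ∧ (v = b (i + 1) ∨ v = b (i - 1)) := by
  have hne : u ≠ v := by
    rintro rfl
    have := huv.1.2
    simp at this
  obtain ⟨i, hi⟩ := (h.boundary.2.2 _).mp huv
  have h1 : u ∈ ({b i, b (i + 1)} : Finset V) := by rw [← hi]; simp
  have h2 : v ∈ ({b i, b (i + 1)} : Finset V) := by rw [← hi]; simp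
  simp only [Finset.mem_insert, Finset.mem_singleton] at h1 h2
  rcases h1 with rfl | rfl <;> rcases h2 with rfl | rfl
  · exact absurd rfl hne
  · exact ⟨i, rfl, Or.inl rfl⟩
  · exact ⟨i + 1, rfl, Or.inr (by rw [add_sub_cancel_right])⟩
  · exact absurd rfl hne

theorem neighbours_of_isBoundaryEdge (h : IsSawBladeIdentification D b q K c) {u x y : V}
    (hx : IsBoundaryEdge D {u, x}) (hy : IsBoundaryEdge D {u, y}) (hxy : x ≠ y) :
    ∃ i, u = b i ∧ ((x = b (i + 1) ∧ y = b (i - 1)) ∨ (x = b (i - 1) ∧ y = b (i + 1))) := by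
  obtain ⟨i, hi, hx'⟩ := h.exists_index_of_isBoundaryEdge hx
  obtain ⟨i', hi', hy'⟩ := h.exists_index_of_isBoundaryEdge hy
  obtain rfl : i = i' := h.boundary.2.1 (hi.symm.trans hi')
  refine ⟨i, hi, ?_⟩
  rcases hx' with e | e <;> rcases hy' with e' | e'
  · exact absurd (e.trans e'.symm) hxy
  · exact Or.inl ⟨e, e'⟩
  · exact Or.inr ⟨e, e'⟩
  · exact absurd (e.trans e'.symm) hxy

/-- The boundary cycle contains no triangle. -/
theorem not_boundary_triangle (h : IsSawBladeIdentification D b q K c) {u x y : V}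
    (hx : IsBoundaryEdge D {u, x}) (hy : IsBoundaryEdge D {u, y})
    (hxy : IsBoundaryEdge D {x, y}) : False := by
  have hne : x ≠ y := by
    rintro rfl
    have := hxy.1.2
    simp at this
  obtain ⟨i, rfl, e⟩ := h.neighbours_of_isBoundaryEdge hx hy hne
  have hb := h.boundary.2.1
  have h1 := h.natCast_ne_zero (a := 1) (by norm_num) (by norm_num)
  have h3 := h.natCast_ne_zero (a := 3) (by norm_num) (by norm_num)
  push_cast at h1 h3
  obtain ⟨k, e1, e2⟩ := h.exists_index_of_isBoundaryEdge hxy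
  rcases e with ⟨rfl, rfl⟩ | ⟨rfl, rfl⟩ <;> simp only [hb.eq_iff] at e1 e2 <;>
    rcases e2 with e2 | e2
  · exact h3 (by linear_combination e1 - e2)
  · exact h1 (by linear_combination e1 - e2)
  · exact h1 (by linear_combination e2 - e1)
  · exact h3 (by linear_combination e2 - e1)

/-- The boundary cycle contains no quadrilateral. -/
theorem not_boundary_quadrilateral (h : IsSawBladeIdentification D b q K c) {u w x y : V}
    (huw : u ≠ w) (hxy : x ≠ y) (hux : IsBoundaryEdge D {u, x}) (huy : IsBoundaryEdge D {u, y})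
    (hwx : IsBoundaryEdge D {w, x}) (hwy : IsBoundaryEdge D {w, y}) : False := by
  have hb := h.boundary.2.1
  have h4 := h.natCast_ne_zero (a := 4) (by norm_num) (by norm_num)
  push_cast at h4
  obtain ⟨i, rfl, e⟩ := h.neighbours_of_isBoundaryEdge hux huy hxy
  obtain ⟨k, rfl, e'⟩ := h.neighbours_of_isBoundaryEdge hwx hwy hxy
  have hik : i ≠ k := fun e => huw (by rw [e])
  rcases e with ⟨rfl, rfl⟩ | ⟨rfl, rfl⟩ <;> simp only [hb.eq_iff] at e' <;>
    rcases e' with ⟨e1, e2⟩ | ⟨e1, e2⟩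
  · exact hik (by linear_combination e1)
  · exact h4 (by linear_combination e1 - e2)
  · exact h4 (by linear_combination e2 - e1)
  · exact hik (by linear_combination e1)

/-- If two faces of the disk have the same image and a vertex of one corresponds to a different
vertex of the other, then all edges of the first face at this vertex are boundary edges. -/
theorem isBoundaryEdge_of_moved (h : IsSawBladeIdentification D b q K c) {s t : Finset V}
    (hs : s ∈ D.faces) (ht : t ∈ D.faces) (hst : s.image q = t.image q) {v w x : V}
    (hv : v ∈ s) (hw : w ∈ t) (hvw : q v = q w) (hne : v ≠ w) (hx : x ∈ s) (hxv : x ≠ v) :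
    IsBoundaryEdge D {v, x} := by
  have hq : q v ≠ q x := fun e => hxv (h.nondegenerate s hs hx hv e.symm)
  obtain ⟨x', hx', e⟩ : ∃ x' ∈ t, q x' = q x := by
    rw [← Finset.mem_image, ← hst]
    exact Finset.mem_image_of_mem q hx
  have hE : ({v, x} : Finset V) ∈ D.faces :=
    mem_faces_of_subset D hs (by simp [Finset.insert_subset_iff, hv, hx]) ⟨v, by simp⟩
  have hE' : ({w, x'} : Finset V) ∈ D.faces :=
    mem_faces_of_subset D ht (by simp [Finset.insert_subset_iff, hw, hx']) ⟨w, by simp⟩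
  by_contra hb
  have := h.interior_edges _ {w, x'} ⟨hE, Finset.card_pair hxv.symm⟩ hb
    ⟨hE', Finset.card_pair (by rintro rfl; exact hq (by rw [hvw, e]))⟩
    (by simp [Finset.image_insert, hvw, e])
  have hw' : w ∈ ({v, x} : Finset V) := by rw [this]; simp
  simp only [Finset.mem_insert, Finset.mem_singleton] at hw'
  rcases hw' with rfl | rfl
  · exact hne rfl
  · exact hq hvw

/-- No two triangles of the disk are identified. -/
theorem triangle_injective (h : IsSawBladeIdentification D b q K c) {s t : Finset V}
    (hs : s ∈ D.faces) (ht : t ∈ D.faces) (hs3 : s.card = 3) (hst : s.image q = t.image q) :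
    s = t := by
  have hcard : t.card = s.card := by
    rw [← Finset.card_image_of_injOn (h.nondegenerate s hs), hst,
      Finset.card_image_of_injOn (h.nondegenerate t ht)]
  by_contra hne
  obtain ⟨v, hv, hvt⟩ : ∃ v ∈ s, v ∉ t := by
    by_contra! hsub
    exact hne (Finset.eq_of_subset_of_card_le hsub hcard.le)
  obtain ⟨w, hw, hvw⟩ := exists_corresponding hst hv
  have hvw' : v ≠ w := by rintro rfl; exact hvt hw
  -- If a second vertex of `s` were moved, all three edges of `s` would be boundary edges. So only
  -- `v` moves, and then `v`, `w` and the two common vertices span a boundary quadrilateral.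
  have hfix : ∀ x ∈ s, x ≠ v → x ∈ t ∧ x ≠ w := by
    intro x hx hxv
    obtain ⟨x', hx', e⟩ := exists_corresponding hst hx
    by_cases hxx : x = x'
    · subst hxx
      refine ⟨hx', ?_⟩
      rintro rfl
      exact hxv (h.nondegenerate s hs hx hv hvw.symm)
    · exfalso
      obtain ⟨y, hy, hyv, hyx⟩ : ∃ y ∈ s, y ≠ v ∧ y ≠ x := by
        obtain ⟨y, hy⟩ : (s \ {v, x}).Nonempty := by
          rw [← Finset.card_pos]
          have := Finset.le_card_sdiff {v, x} s
          have := Finset.card_le_two (a := v) (b := x)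
          lia
        simp only [Finset.mem_sdiff, Finset.mem_insert, Finset.mem_singleton, not_or] at hy
        exact ⟨y, hy.1, hy.2.1, hy.2.2⟩
      exact h.not_boundary_triangle
        (h.isBoundaryEdge_of_moved hs ht hst hv hw hvw hvw' hx hxv)
        (h.isBoundaryEdge_of_moved hs ht hst hv hw hvw hvw' hy hyv)
        (h.isBoundaryEdge_of_moved hs ht hst hx hx' e hxx hy hyx)
  obtain ⟨x, y, hxy, hxy'⟩ := Finset.card_eq_two.mp
    (show (s.erase v).card = 2 by rw [Finset.card_erase_of_mem hv, hs3])
  have hx : x ≠ v ∧ x ∈ s := Finset.mem_erase.mp (by rw [hxy']; simp)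
  have hy : y ≠ v ∧ y ∈ s := Finset.mem_erase.mp (by rw [hxy']; simp)
  have hx' := hfix x hx.2 hx.1
  have hy' := hfix y hy.2 hy.1
  exact h.not_boundary_quadrilateral hvw' hxy
    (h.isBoundaryEdge_of_moved hs ht hst hv hw hvw hvw' hx.2 hx.1)
    (h.isBoundaryEdge_of_moved hs ht hst hv hw hvw hvw' hy.2 hy.1)
    (h.isBoundaryEdge_of_moved ht hs hst.symm hw hv hvw.symm hvw'.symm hx'.1 hx'.2)
    (h.isBoundaryEdge_of_moved ht hs hst.symm hw hv hvw.symm hvw'.symm hy'.1 hy'.2)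

/-- Distinct faces of the disk with the same image lie on the boundary. -/
theorem eq_or_mem_cycleComplex (h : IsSawBladeIdentification D b q K c) {s t : Finset V}
    (hs : s ∈ D.faces) (ht : t ∈ D.faces) (hst : s.image q = t.image q) :
    s = t ∨ s ∈ (cycleComplex b).faces ∧ t ∈ (cycleComplex b).faces := by
  have hcard : t.card = s.card := by
    rw [← Finset.card_image_of_injOn (h.nondegenerate s hs), hst,
      Finset.card_image_of_injOn (h.nondegenerate t ht)]
  have hsne := (D.isRelLowerSet_faces hs).1
  have htne := (D.isRelLowerSet_faces ht).1
  have hpos := hsne.card_pos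
  have hle := h.disk.1 s hs
  obtain h1 | h2 | h3 : s.card = 1 ∨ s.card = 2 ∨ s.card = 3 := by lia
  · rw [h1] at hcard
    obtain ⟨u, rfl⟩ := Finset.card_eq_one.mp h1
    obtain ⟨w, rfl⟩ := Finset.card_eq_one.mp hcard
    by_cases huw : u = w
    · exact Or.inl (by rw [huw])
    · obtain ⟨⟨i, rfl⟩, ⟨k, rfl⟩⟩ := h.only_boundary u w hs ht (by simpa using hst) huw
      exact Or.inr ⟨⟨hsne, i, by simp⟩, ⟨htne, k, by simp⟩⟩
  · by_cases hsb : IsBoundaryEdge D s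
    · by_cases htb : IsBoundaryEdge D t
      · obtain ⟨i, hi⟩ := (h.boundary.2.2 _).mp hsb
        obtain ⟨k, hk⟩ := (h.boundary.2.2 _).mp htb
        exact Or.inr ⟨⟨hsne, i, hi.le⟩, ⟨htne, k, hk.le⟩⟩
      · exact Or.inl (h.interior_edges t s ⟨ht, hcard.trans h2⟩ htb ⟨hs, h2⟩ hst.symm).symm
    · exact Or.inl (h.interior_edges s t ⟨hs, h2⟩ hsb ⟨ht, hcard.trans h2⟩ hst)
  · exact Or.inl (h.triangle_injective hs ht h3 hst)

theorem not_isFreeFace (h : IsSawBladeIdentification D b q K c) (σ τ : Finset W) :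
    ¬ IsFreeFace K σ τ := by
  rintro ⟨hσ, hτ, hcard, hfree⟩
  obtain rfl := h.image_eq
  obtain ⟨s, hs, rfl⟩ := hσ
  obtain ⟨t, ht, rfl⟩ := hτ
  simp only at hcard hfree
  have hst := ((hfree _).mpr rfl).2
  have hpos := (D.isRelLowerSet_faces hs).1.card_pos
  have hle := h.disk.1 t ht
  have hcs := Finset.card_image_of_injOn (h.nondegenerate s hs)
  have hct := Finset.card_image_of_injOn (h.nondegenerate t ht)
  obtain h2 | h3 : t.card = 2 ∨ t.card = 3 := by lia
  -- A free vertex is impossible: its edge lies in a triangle, which is a second face containing the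
  -- vertex.
  · obtain ⟨T, hT, hT3, htT⟩ := exists_triangle_of_isEdge h.disk ⟨ht, h2⟩
    have := (hfree (T.image q)).mp
      ⟨⟨T, hT, rfl⟩, hst.trans_subset (Finset.image_subset_image htT)⟩
    have hcT := Finset.card_image_of_injOn (h.nondegenerate T hT)
    rw [this] at hcT
    lia
  · have hs2 : s.card = 2 := by lia
    have hτ : ∀ T ∈ D.faces, T.card = 3 → s.image q ⊆ T.image q → T = t := by
      intro T hT hT3 hsT
      refine h.triangle_injective hT ht hT3 ((hfree _).mp ⟨⟨T, hT, rfl⟩, ?_⟩)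
      refine Finset.ssubset_iff_subset_ne.mpr ⟨hsT, fun e => ?_⟩
      have hcT := Finset.card_image_of_injOn (h.nondegenerate T hT)
      rw [← e] at hcT
      lia
    obtain ⟨T, hT, hT3, hsT⟩ := exists_triangle_of_isEdge h.disk ⟨hs, hs2⟩
    obtain rfl := hτ T hT hT3 (Finset.image_subset_image hsT)
    have hsb : IsBoundaryEdge D s :=
      ⟨⟨hs, hs2⟩, T, ⟨hT, hT3, hsT⟩, fun T' hT' =>
        hτ T' hT'.1 hT'.2.1 (Finset.image_subset_image hT'.2.2)⟩
    obtain ⟨i, rfl⟩ := (h.boundary.2.2 _).mp hsb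
    -- A second boundary edge has the same image, so its triangle must also be `T`. As `q` is
    -- injective on `T`, the two edges coincide, contradicting `k ≠ i`.
    obtain ⟨k, hk, hki⟩ := Set.exists_ne_of_one_lt_ncard
      (by rw [h.edges_three i]; norm_num) i
    have hk' : ({b k, b (k + 1)} : Finset V).image q = ({b i, b (i + 1)} : Finset V).image q := by
      simpa [Finset.image_insert] using hk
    have hkb := h.isBoundaryEdge_pair k
    obtain ⟨T', hT', hT3', hsT'⟩ := exists_triangle_of_isEdge h.disk hkb.1
    obtain rfl := hτ T' hT' hT3' (hk' ▸ Finset.image_subset_image hsT')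
    have hinj := h.nondegenerate _ hT'
    have hmem : ∀ v ∈ ({b k, b (k + 1)} : Finset V), v ∈ ({b i, b (i + 1)} : Finset V) := by
      intro v hv
      obtain ⟨w, hw, e⟩ := exists_corresponding hk' hv
      rwa [hinj (hsT' hv) (hsT hw) e]
    have e1 := hmem (b k) (by simp)
    have e2 := hmem (b (k + 1)) (by simp)
    have h1 := h.natCast_ne_zero (a := 1) (by norm_num) (by norm_num)
    have h2 := h.natCast_ne_zero (a := 2) (by norm_num) (by norm_num)
    push_cast at h1 h2
    simp only [Finset.mem_insert, Finset.mem_singleton, h.boundary.2.1.eq_iff, hki, false_or]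
      at e1 e2
    rcases e2 with e2 | e2
    · exact h2 (by linear_combination e2 - e1)
    · exact hki (add_right_cancel e2)

theorem not_isCollapsible (h : IsSawBladeIdentification D b q K c) : ¬ IsCollapsible K := by
  rintro ⟨L, v, hL, hKL⟩
  rcases Relation.ReflTransGen.cases_head hKL with rfl | ⟨M, ⟨σ, τ, hfree, -⟩, -⟩
  · have h0 := h.pair_mem_faces 0
    have h1 : ({c 0, c (0 + 1)} : Finset W).card = 2 := by
      have : Fact (1 < n) := ⟨by have := h.three_le; lia⟩
      exact Finset.card_pair (fun e => by simpa using h.cycle_injective e)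
    rw [hL] at h0
    rw [Set.mem_singleton_iff.mp h0] at h1
    simp at h1
  · exact h.not_isFreeFace σ τ hfree

end IsSawBladeIdentification

end Identification

/-! ### The projection of realizations induced by the vertex identification -/

section VertexMap

variable {V W : Type*} [Fintype V] [DecidableEq W]

/-- The linear map on barycentric coordinates induced by a map of vertices. -/
noncomputable def vertexMap (q : V → W) : (V → ℝ) →ₗ[ℝ] (W → ℝ) :=
  LinearMap.pi fun w => ∑ v ∈ Finset.univ.filter (fun v => q v = w), LinearMap.proj v

theorem vertexMap_apply (q : V → W) (x : V → ℝ) (w : W) :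
    vertexMap q x w = ∑ v ∈ Finset.univ.filter (fun v => q v = w), x v := by
  simp [vertexMap]

theorem vertexMap_single [DecidableEq V] (q : V → W) (u : V) :
    vertexMap q (Pi.single u 1) = Pi.single (q u) 1 := by
  ext w
  rw [vertexMap_apply, Finset.sum_pi_single']
  by_cases hw : q u = w
  · simp [hw.symm]
  · simp [hw, Ne.symm hw]

theorem continuous_vertexMap (q : V → W) : Continuous (vertexMap q) := by
  refine continuous_pi fun w => ?_
  simp only [vertexMap_apply]
  fun_prop

theorem vertexMap_apply_of_injOn {q : V → W} {s : Finset V} (hq : InjOn q s) {x : V → ℝ}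
    (hx : ∀ v, x v ≠ 0 → v ∈ s) {v : V} (hv : v ∈ s) : vertexMap q x (q v) = x v := by
  rw [vertexMap_apply]
  refine Finset.sum_eq_single_of_mem v (by simp) fun u hu huv => ?_
  by_contra hu0
  exact huv (hq (hx u hu0) hv (by simpa using hu))

theorem vertexMap_apply_eq_zero {q : V → W} {s : Finset V} {x : V → ℝ}
    (hx : ∀ v, x v ≠ 0 → v ∈ s) {w : W} (hw : w ∉ s.image q) : vertexMap q x w = 0 := by
  rw [vertexMap_apply]
  refine Finset.sum_eq_zero fun u hu => ?_
  by_contra hu0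
  exact hw (Finset.mem_image.mpr ⟨u, hx u hu0, by simpa using hu⟩)

variable [Fintype W] {D : PreAbstractSimplicialComplex V} {q : V → W}

theorem vertexMap_mem {x : V → ℝ} (hx : x ∈ realization D) :
    vertexMap q x ∈ realization (D.map q) := by
  obtain ⟨hx, s, hs, h⟩ := hx
  refine ⟨⟨fun w => ?_, ?_⟩, s.image q, ⟨s, hs, rfl⟩, fun w hw => ?_⟩
  · rw [vertexMap_apply]
    exact Finset.sum_nonneg fun v _ => hx.1 v
  · simp only [vertexMap_apply]
    rw [Finset.sum_fiberwise, hx.2]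
  · by_contra hw'
    exact hw (vertexMap_apply_eq_zero h hw')

theorem exists_vertexMap_eq (hq : ∀ s ∈ D.faces, InjOn q (s : Set V)) {y : W → ℝ}
    (hy : y ∈ realization (D.map q)) : ∃ x ∈ realization D, vertexMap q x = y := by
  classical
  obtain ⟨hy, _, ⟨s, hs, rfl⟩, h⟩ := hy
  let x : V → ℝ := fun v => if v ∈ s then y (q v) else 0
  have hxs : ∀ v, x v ≠ 0 → v ∈ s := fun v hv => by
    by_contra hvs
    exact hv (if_neg hvs)
  refine ⟨x, ⟨⟨fun v => ?_, ?_⟩, s, hs, hxs⟩, ?_⟩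
  · simp only [x]
    split_ifs
    exacts [hy.1 _, le_rfl]
  · rw [← hy.2]
    simp only [x, Finset.sum_ite_mem, Finset.univ_inter]
    rw [← Finset.sum_image (hq s hs)]
    refine Finset.sum_subset (Finset.subset_univ _) fun w _ hw => ?_
    by_contra hw0
    exact hw (h w hw0)
  · ext w
    by_cases hw : w ∈ s.image q
    · obtain ⟨v, hv, rfl⟩ := Finset.mem_image.mp hw
      rw [vertexMap_apply_of_injOn (hq s hs) hxs hv]
      exact if_pos hv
    · rw [vertexMap_apply_eq_zero hxs hw]
      by_contra hw0
      exact hw (h w (Ne.symm hw0))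

theorem image_supp (hq : ∀ s ∈ D.faces, InjOn q (s : Set V)) {x : V → ℝ}
    (hx : x ∈ realization D) : (Finset.univ.filter fun v => x v ≠ 0).image q =
      Finset.univ.filter fun w => vertexMap q x w ≠ 0 := by
  have hs := supp_mem_faces hx
  ext w
  simp only [Finset.mem_filter, Finset.mem_univ, true_and]
  constructor
  · intro hw
    obtain ⟨v, hv, rfl⟩ := Finset.mem_image.mp hw
    rw [vertexMap_apply_of_injOn (hq _ hs) (by simp) hv]
    simpa using hv
  · intro hw
    by_contra hw'
    exact hw (vertexMap_apply_eq_zero (by simp) hw')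

end VertexMap

theorem realization_mono {V : Type*} [Fintype V] {A D : PreAbstractSimplicialComplex V}
    (h : A.faces ⊆ D.faces) : realization A ⊆ realization D :=
  fun _ ⟨hx, s, hs, hxs⟩ => ⟨hx, s, h hs, hxs⟩

/-! ### Contractibility of the saw blade complex -/

namespace IsSawBladeIdentification

variable {V W : Type*} [Fintype V] [DecidableEq V] [DecidableEq W]
  {D : PreAbstractSimplicialComplex V} {m : ℕ} {b : ZMod m → V} {q : V → W}
  {K : PreAbstractSimplicialComplex W} {n : ℕ} {c : ZMod n → W}

theorem cycleComplex_boundary_subset (h : IsSawBladeIdentification D b q K c) :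
    (cycleComplex b).faces ⊆ D.faces := by
  rintro s ⟨hs, i, hi⟩
  exact mem_faces_of_subset D (h.isBoundaryEdge_pair i).1.1 hi hs

theorem cycleComplex_image_subset (h : IsSawBladeIdentification D b q K c) :
    (cycleComplex c).faces ⊆ K.faces := by
  rintro s ⟨hs, k, hk⟩
  exact mem_faces_of_subset K (h.pair_mem_faces k) hk hs

theorem eq_or_mem_of_vertexMap_eq [Fintype W] (h : IsSawBladeIdentification D b q K c)
    {x y : V → ℝ} (hx : x ∈ realization D) (hy : y ∈ realization D)
    (hxy : vertexMap q x = vertexMap q y) :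
    x = y ∨ x ∈ realization (cycleComplex b) ∧ y ∈ realization (cycleComplex b) := by
  have hs := supp_mem_faces hx
  have ht := supp_mem_faces hy
  have hst := image_supp h.nondegenerate hx
  rw [hxy, ← image_supp h.nondegenerate hy] at hst
  rcases h.eq_or_mem_cycleComplex hs ht hst with e | ⟨hs', ht'⟩
  · left
    ext v
    by_cases hv : v ∈ Finset.univ.filter fun v => x v ≠ 0
    · rw [← vertexMap_apply_of_injOn (x := x) (h.nondegenerate _ hs) (by simp) hv, hxy]
      exact vertexMap_apply_of_injOn (h.nondegenerate _ ht) (by simp) (e ▸ hv)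
    · have hv' : v ∉ Finset.univ.filter fun v => y v ≠ 0 := e ▸ hv
      simp only [ne_eq, Finset.mem_filter, Finset.mem_univ, true_and, not_not] at hv hv'
      rw [hv, hv']
  · exact Or.inr ⟨⟨hx.1, _, hs', by simp⟩, ⟨hy.1, _, ht', by simp⟩⟩

theorem contractibleSpace [Fintype W] (h : IsSawBladeIdentification D b q K c) :
    ContractibleSpace (realization K) := by
  classical
  obtain ⟨φ, hφ, step, fib, orient⟩ := h.exists_walk
  have hm := h.boundary.1
  have hn := h.three_le
  have hb := h.boundary.2.1
  have hc := h.cycle_injective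
  obtain ⟨-, δ, Φ, hδ, hΦφ, hΦ, hΦm⟩ := exists_lift_of_walk hm hn φ step fib orient
  obtain ⟨e, H, hH, H₀, H₁⟩ :=
    exists_homotopy_homeomorph (m := m) (n := n) (by lia) (by lia) hδ hΦm
  have : Fact (0 < (m : ℝ)) := ⟨by exact_mod_cast (by lia : 0 < m)⟩
  have := compactSpace_realization D h.disk
  have := contractibleSpace_realization D h.disk
  have hbm : ∀ θ, polygonMap b θ ∈ realization (cycleComplex b) := fun θ =>
    range_polygonMap hb hm ▸ mem_range_self θ
  have hcm : ∀ θ, polygonMap c θ ∈ realization (cycleComplex c) := fun θ =>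
    range_polygonMap hc hn ▸ mem_range_self θ
  let p : realization D → realization K := fun x =>
    ⟨vertexMap q x, h.image_eq ▸ vertexMap_mem x.2⟩
  let a : AddCircle (m : ℝ) → realization D := fun θ =>
    ⟨polygonMap b θ, realization_mono h.cycleComplex_boundary_subset (hbm θ)⟩
  let j : AddCircle (n : ℝ) → realization K := fun θ =>
    ⟨polygonMap c θ, realization_mono h.cycleComplex_image_subset (hcm θ)⟩
  have ha : Continuous a := (continuous_polygonMap b).subtype_mk _
  have hai : Function.Injective a := fun x y hxy =>
    polygonMap_injective hb hm (congrArg Subtype.val hxy)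
  have hrange : ∀ x : realization D, x.1 ∈ realization (cycleComplex b) → x ∈ range a := by
    intro x hx
    rw [← range_polygonMap hb hm] at hx
    obtain ⟨θ, hθ⟩ := hx
    exact ⟨θ, Subtype.ext hθ⟩
  have hp : Continuous p := ((continuous_vertexMap q).comp continuous_subtype_val).subtype_mk _
  have hps : Function.Surjective p := by
    rintro ⟨y, hy⟩
    rw [h.image_eq] at hy
    obtain ⟨x, hx, rfl⟩ := exists_vertexMap_eq h.nondegenerate hy
    exact ⟨⟨x, hx⟩, rfl⟩
  let A := cycleComplex b
  let α : realization D → ℝ := fun x => mass A x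
  -- Meaningful only on the collar `1 / 2 ≤ α`, where the deformation ends on the boundary polygon;
  -- `invFun` gives a junk value where it does not. Continuity on the collar follows because `a` is
  -- a closed embedding.
  let r : realization D → AddCircle (m : ℝ) := fun x =>
    Function.invFun a (deform D A (x, 1))
  have hd1 : ∀ x, (deform D A (x, 1)).1 = pushNormalized A x := fun x => by simp [deform]
  have har : ∀ x, 1 / 2 ≤ α x → deform D A (x, 1) = a (r x) := fun x hx =>
    (Function.invFun_eq (hrange _ (by rw [hd1]; exact pushNormalized_mem A x.2.1 hx))).symm
  have hr : ContinuousOn r {x | 1 / 2 ≤ α x} := by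
    rw [(ha.isClosedEmbedding hai).isInducing.continuousOn_iff]
    have := continuous_deform D A
    exact ContinuousOn.congr (f := fun x => deform D A (x, 1)) (by fun_prop)
      fun x hx => (har x hx).symm
  refine contractibleSpace_of_attaching (p := p) hp hps ha hai (j := j)
    ((continuous_polygonMap c).subtype_mk _)
    (fun x y hxy => polygonMap_injective hc hn (congrArg Subtype.val hxy)) ?_
    (f := fun θ => H (θ, 0)) ?_ e hH (fun _ => rfl) H₁ (α := α)
    ((continuous_mass A).comp continuous_subtype_val) (fun θ => mass_eq_one (hbm θ)) hr
    (continuous_deform D A) (fun x => ?_) har (fun θ s => ?_)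
  · intro x y hxy
    rcases h.eq_or_mem_of_vertexMap_eq x.2 y.2 (congrArg Subtype.val hxy) with e | ⟨h1, h2⟩
    · exact Or.inl (Subtype.ext e)
    · exact Or.inr ⟨hrange x h1, hrange y h2⟩
  · intro θ
    obtain ⟨t, rfl⟩ := QuotientAddGroup.mk_surjective θ
    apply Subtype.ext
    change vertexMap q (polygonPath b t) = polygonMap c (H ((t : AddCircle (m : ℝ)), 0))
    -- Both sides are the interpolation of the vertices `c (Φ i)`: the projection is linear, and `Φ`
    -- moves by unit steps.
    rw [H₀, polygonMap_coe, polygonPath, polygonPath, map_interp, interp_interp _ hΦ]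
    simp only [vertexMap_single, hφ, hΦφ]
  · ext v
    simp [deform]
  · ext v
    change (1 - (s : ℝ)) * polygonMap b θ v +
      s * pushNormalized (cycleComplex b) (polygonMap b θ) v = polygonMap b θ v
    rw [pushNormalized_eq_self (hbm θ)]
    ring

end IsSawBladeIdentification

end SawBlade

theorem mainTheorem1 {W : Type*} [Fintype W] [DecidableEq W]
    (K : PreAbstractSimplicialComplex W) (hK : SawBlade.IsSawBladeComplex K) :
    ContractibleSpace (SawBlade.realization K) ∧ ¬ SawBlade.IsCollapsible K := by
  obtain ⟨V, _, _, D, m, b, q, n, c, h⟩ := hK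
  exact ⟨h.contractibleSpace, h.not_isCollapsible⟩
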